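/- **Tarski's Theorem.** Theories are theories in classical first-order logic with equality, and $\vdash$ is derivability. A predicate is a formula in one free variable, and $\mathrm{sub}(P,t)=P(t)$ is the sentence obtained by substituting the closed term $t$ in the predicate $P$. A theory is *decidable* if it is consistent and complete, i.e. no sentence is both proved and refuted, and every sentence is proved or refuted. A theory $\mathrm{META}$ is *meta* to a theory $\mathrm{Th}$ if all strings over the alphabet of $\mathrm{Th}$ are closed terms of $\mathrm{META}$ (different strings being different terms). A *modelling transformation* $g$ from $\mathrm{META}$ to $\mathrm{Th}$ maps closed terms, predicates and sentences of $\mathrm{META}$ to closed terms, predicates and sentences of $\mathrm{Th}$ such that $$\mathrm{Th}\vdash g(\neg S)\leftrightarrow\neg g(S),\qquad \mathrm{Th}\vdash g(S\vee S')\leftrightarrow g(S)\vee g(S'),$$ $$\mathrm{Th}\vdash g(\exists x\,P(x))\leftrightarrow\exists x\,g(P)(x),\qquad \mathrm{Th}\vdash g(\mathrm{sub}(P,t))\leftrightarrow \mathrm{sub}(g(P),g(t))$$ for all sentences $S,S'$, predicates $P$ and closed terms $t$ of $\mathrm{META}$, and such that $\mathrm{META}\vdash S$ implies $\mathrm{Th}\vdash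 g(S)$. Let $\mathrm{META}$ be a decidable theory that is meta to a theory $\mathrm{Th}$, and let $g$ be a modelling transformation from $\mathrm{META}$ to $\mathrm{Th}$. Suppose that $\mathrm{META}$ contains substitution, i.e. that there is a formula $\sigma(x,y,z)$ of $\mathrm{META}$ such that, for every predicate $P$ of $\mathrm{META}$ and every string $t$ over the alphabet of $\mathrm{Th}$, $$\mathrm{META}\vdash\forall z\,\bigl(\sigma(g(P),t,z)\leftrightarrow z=g(\mathrm{sub}(P,t))\bigr),$$ where the predicate $g(P)$ and the sentence $g(\mathrm{sub}(P,t))$ of $\mathrm{Th}$ are strings over the alphabet of $\mathrm{Th}$, and therefore, like $t$ itself, closed terms of $\mathrm{META}$. Then $\mathrm{META}$ does not contain a truth predicate: there is no predicate $\mathrm{True}$ of $\mathrm{META}$ such that $$\mathrm{META}\vdash \mathrm{True}(g(S))\leftrightarrow S\qquad\text{for all sentences } S \text{ of } \mathrm{META}.$$ -/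

import Mathlib

universe u v u' v'

namespace StringTheory

/-! ### Predicates, sentences and substitution

Closed terms are elements of `L.Term Empty`, sentences are elements of `L.Sentence`, and predicates
are formulas with exactly one free-variable slot. -/

/-- Predicates of a language: formulas in one free variable. -/
abbrev Predicate (L : FirstOrder.Language.{u, v}) := L.Formula (Fin 1)

variable {L : FirstOrder.Language.{u, v}} {L' : FirstOrder.Language.{u', v'}}

/-- `sub P t` is the sentence `P(t)`: the closed term `t` substituted for the variable of `P`. -/
def sub (P : Predicate L) (t : L.Term Empty) : L.Sentence :=
  P.subst fun _ => t

/-- The sentence `∀ x, P x`. -/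
def forallSentence (P : Predicate L) : L.Sentence :=
  (FirstOrder.Language.BoundedFormula.relabel (n := 1) (fun i => (Sum.inr i : Empty ⊕ Fin 1)) P).all

/-- The sentence `∃ x, P x`. -/
def existsSentence (P : Predicate L) : L.Sentence :=
  (FirstOrder.Language.BoundedFormula.relabel (n := 1) (fun i => (Sum.inr i : Empty ⊕ Fin 1)) P).ex

/-- A closed term, regarded as a term in which variables from `α` might have occurred. -/
def closedTerm {α : Type} (t : L.Term Empty) : L.Term α :=
  t.subst fun e => e.elim

/-- A sentence, regarded as a formula in which variables from `ℕ` might have occurred. -/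
def openSentence (S : L.Sentence) : L.Formula ℕ :=
  S.subst fun e => e.elim

/-! ### The predicate calculus

Natural deduction for classical first-order logic with equality. The primitive connectives are
`⊥`, `=`, `⟹` and `∀`; negation, disjunction, conjunction and `∃` are the usual abbreviations.
Free variables are numbered by `ℕ`. -/

/-- `φ(t)`, for a formula `φ` with one distinguished variable `Sum.inr 0`. -/
def instantiate (φ : L.Formula (ℕ ⊕ Fin 1)) (t : L.Term ℕ) : L.Formula ℕ :=
  φ.subst (Sum.elim FirstOrder.Language.Term.var fun _ => t)

/-- Renumbering of the free variables that makes the variable `0` fresh. -/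
def shift (φ : L.Formula ℕ) : L.Formula ℕ :=
  φ.subst fun i => FirstOrder.Language.Term.var (i + 1)

/-- `φ` is derivable from the hypotheses `Γ` in the classical predicate calculus with equality. -/
inductive Derivable : Set (L.Formula ℕ) → L.Formula ℕ → Prop
  | hyp {Γ : Set (L.Formula ℕ)} {φ : L.Formula ℕ} : φ ∈ Γ → Derivable Γ φ
  | impIntro {Γ : Set (L.Formula ℕ)} {φ ψ : L.Formula ℕ} :
      Derivable (insert φ Γ) ψ → Derivable Γ (φ.imp ψ)
  | impElim {Γ : Set (L.Formula ℕ)} {φ ψ : L.Formula ℕ} :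
      Derivable Γ (φ.imp ψ) → Derivable Γ φ → Derivable Γ ψ
  | byContradiction {Γ : Set (L.Formula ℕ)} {φ : L.Formula ℕ} :
      Derivable (insert φ.not Γ) ⊥ → Derivable Γ φ
  | allIntro {Γ : Set (L.Formula ℕ)} {φ : L.BoundedFormula ℕ 1} :
      Derivable (shift '' Γ)
        (φ.toFormula.subst
          (Sum.elim (fun i => FirstOrder.Language.Term.var (i + 1)) fun _ => FirstOrder.Language.Term.var 0)) →
      Derivable Γ φ.all
  | allElim {Γ : Set (L.Formula ℕ)} {φ : L.BoundedFormula ℕ 1} (t : L.Term ℕ) :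
      Derivable Γ φ.all → Derivable Γ (instantiate φ.toFormula t)
  | eqRefl {Γ : Set (L.Formula ℕ)} (t : L.Term ℕ) : Derivable Γ (t.equal t)
  | eqSubst {Γ : Set (L.Formula ℕ)} (φ : L.Formula (ℕ ⊕ Fin 1)) {s t : L.Term ℕ} :
      Derivable Γ (s.equal t) → Derivable Γ (instantiate φ s) → Derivable Γ (instantiate φ t)

/-- `Proves T S` is `T ⊢ S`: the sentence `S` is derivable from the axioms `T`. -/
def Proves (T : L.Theory) (S : L.Sentence) : Prop :=
  Derivable (openSentence '' T) (openSentence S)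

/-- No sentence is both proved and refuted. -/
def IsConsistent (T : L.Theory) : Prop :=
  ∀ S : L.Sentence, ¬ (Proves T S ∧ Proves T S.not)

/-- Every sentence is proved or refuted. -/
def IsComplete (T : L.Theory) : Prop :=
  ∀ S : L.Sentence, Proves T S ∨ Proves T S.not

/-- A decidable theory, in the sense of a theory that decides all its sentences without
contradiction: it is consistent and complete. -/
def IsDecidable (T : L.Theory) : Prop :=
  IsConsistent T ∧ IsComplete T

/-! ### Strings -/

/-- The alphabet of a language: variables, function and relation symbols, logical symbols. -/
inductive Letter (L : FirstOrder.Language.{u, v}) : Type max u v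
  | free (i : ℕ) : Letter L
  | bound (i : ℕ) : Letter L
  | func {n : ℕ} (f : L.Functions n) : Letter L
  | rel {n : ℕ} (R : L.Relations n) : Letter L
  | falsum : Letter L
  | equal : Letter L
  | imp : Letter L
  | all : Letter L

/-- The term `t` as a string, in Polish notation, with `v a` the letter for the variable `a`. -/
def termString {α : Type} (v : α → Letter L) : L.Term α → List (Letter L)
  | .var a => [v a]
  | .func f ts => Letter.func f :: (List.finRange _).flatMap fun i => termString v (ts i)

/-- The letter for a variable of a formula with quantifier depth `n`. -/
def varLetter {α : Type} (v : α → ℕ) {n : ℕ} : α ⊕ Fin n → Letter L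
  | .inl a => Letter.free (v a)
  | .inr i => Letter.bound i

/-- The formula `φ` as a string, in Polish notation, with `v a` the number of the free
variable `a`. -/
def formulaString {α : Type} (v : α → ℕ) : ∀ {n : ℕ}, L.BoundedFormula α n → List (Letter L)
  | _, .falsum => [Letter.falsum]
  | _, .equal s t =>
    Letter.equal :: (termString (varLetter v) s ++ termString (varLetter v) t)
  | _, .rel R ts =>
    Letter.rel R :: (List.finRange _).flatMap fun i => termString (varLetter v) (ts i)
  | _, .imp φ ψ => Letter.imp :: (formulaString v φ ++ formulaString v ψ)
  | _, .all φ => Letter.all :: formulaString v φ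

/-- A sentence as a string over the alphabet of its language. -/
def sentenceString (S : L.Sentence) : List (Letter L) :=
  formulaString (fun e : Empty => e.elim) S

/-- A predicate as a string over the alphabet of its language. -/
def predicateString (P : Predicate L) : List (Letter L) :=
  formulaString (fun i : Fin 1 => (i : ℕ)) P

/-- A theory in the language `L` is meta to a theory in the language `L'`: all strings over the
alphabet of `L'` are closed terms of `L`. The string `s` is the closed term `quote s`, and different
strings are different terms. -/
structure Meta (L : FirstOrder.Language.{u, v}) (L' : FirstOrder.Language.{u', v'}) where
  quote : List (Letter L') → L.Term Empty
  quote_injective : Function.Injective quote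

/-! ### Modelling transformations and truth predicates -/

/-- A modelling transformation from the theory `T` to the theory `T'`: it maps closed terms,
predicates and sentences to closed terms, predicates and sentences, commutes up to provable
equivalence with negation, disjunction, existential quantification and substitution, and preserves
provability. -/
structure ModellingTransformation (T : L.Theory) (T' : L'.Theory) where
  term : L.Term Empty → L'.Term Empty
  pred : Predicate L → Predicate L'
  sent : L.Sentence → L'.Sentence
  map_not : ∀ S : L.Sentence, Proves T' ((sent S.not).iff (sent S).not)
  map_or : ∀ S₁ S₂ : L.Sentence, Proves T' ((sent (S₁ ⊔ S₂)).iff (sent S₁ ⊔ sent S₂))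
  map_exists : ∀ P : Predicate L,
    Proves T' ((sent (existsSentence P)).iff (existsSentence (pred P)))
  map_sub : ∀ (P : Predicate L) (t : L.Term Empty),
    Proves T' ((sent (sub P t)).iff (sub (pred P) (term t)))
  map_proves : ∀ S : L.Sentence, Proves T S → Proves T' (sent S)

variable {T : L.Theory} {T' : L'.Theory}

/-- The formula `σ` of `L` expresses in `T` the substitution function on the strings of `L'`,
via `g`: for every predicate `P` of `L` and every string `t` over the alphabet of `L'`, the theory
`T` proves that `g(P(t))` is the one and only `z` with `σ(g(P), t, z)`. -/
def ExpressesSubstitution (q : Meta L L') (g : ModellingTransformation T T')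
    (σ : L.Formula (Fin 3)) : Prop :=
  ∀ (P : Predicate L) (t : List (Letter L')),
    Proves T (forallSentence
      ((σ.subst ![closedTerm (q.quote (predicateString (g.pred P))), closedTerm (q.quote t),
          FirstOrder.Language.Term.var 0]).iff
        ((FirstOrder.Language.Term.var 0).equal
          (closedTerm (q.quote (sentenceString (g.sent (sub P (q.quote t)))))))))

/-- `Tr` is a truth predicate: `T ⊢ Tr(g(S)) ↔ S` for all sentences `S` of `L`. -/
def IsTruthPredicate (q : Meta L L') (g : ModellingTransformation T T')
    (Tr : Predicate L) : Prop :=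
  ∀ S : L.Sentence, Proves T ((sub Tr (q.quote (sentenceString (g.sent S)))).iff S)

end StringTheory

/-! This is the liar paradox. Put `D(x) := ∀ z, σ(x, x, z) → ¬ Tr z`, let `s` be the string of
`g(D)`, and let `S` be `D(s)`. Because `σ(s, s, ·)` defines the string of `g(S)`, META proves `S`
exactly when it proves `¬ Tr(g(S))` (`proves_sub_diagonal_iff`). The truth scheme turns a proof of
`S` into one of `Tr(g(S))`, and a refutation of `S` into a refutation of `Tr(g(S))`, that is, into a
proof of `S`. So neither case of completeness is consistent. An equivalence of provability is enough
here, since completeness makes the case distinction outside the theory. The rest is syntax: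
`bsubst_bsubst` is the composition law that identifies the formulas produced by the calculus with
the intended instances. -/

namespace StringTheory

open FirstOrder.Language

/-! ### Calculus of substitutions -/

section Substitution

variable {L : FirstOrder.Language.{u, v}} {α β γ : Type}

theorem term_subst_subst {α β γ : Type*} (t : L.Term α) (f : α → L.Term β) (h : β → L.Term γ) :
    (t.subst f).subst h = t.subst fun a => (f a).subst h := by
  induction t with
  | var => rfl
  | func F ts ih => simp only [Term.subst, ih]

theorem term_relabel_eq_subst {α β : Type*} (t : L.Term α) (f : α → β) :
    t.relabel f = t.subst fun a => Term.var (f a) := by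
  induction t with
  | var => rfl
  | func F ts ih => simp only [Term.subst, Term.relabel, ih]

theorem closedTerm_subst (t : L.Term Empty) (f : α → L.Term β) :
    (closedTerm t).subst f = closedTerm t := by
  unfold closedTerm
  rw [term_subst_subst]
  exact congrArg _ (Subsingleton.elim _ _)

/-- Extends a substitution under a quantifier. -/
def liftSubst {n m : ℕ} (ρ : α ⊕ Fin n → L.Term (β ⊕ Fin m)) :
    α ⊕ Fin (n + 1) → L.Term (β ⊕ Fin (m + 1)) :=
  Sum.elim (fun a => (ρ (.inl a)).subst fun x => .var (Sum.map id Fin.castSucc x))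
    (Fin.lastCases (.var (.inr (Fin.last m)))
      fun j => (ρ (.inr j)).subst fun x => .var (Sum.map id Fin.castSucc x))

/-- Simultaneous substitution for the free and the dangling bound variables of a formula. -/
def bsubst : ∀ {n m : ℕ}, (α ⊕ Fin n → L.Term (β ⊕ Fin m)) → L.BoundedFormula α n →
    L.BoundedFormula β m
  | _, _, _, .falsum => .falsum
  | _, _, ρ, .equal s t => .equal (s.subst ρ) (t.subst ρ)
  | _, _, ρ, .rel R ts => .rel R fun i => (ts i).subst ρ
  | _, _, ρ, .imp φ ψ => (bsubst ρ φ).imp (bsubst ρ ψ)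
  | _, _, ρ, .all φ => (bsubst (liftSubst ρ) φ).all

@[simp]
theorem liftSubst_inl {n m : ℕ} (ρ : α ⊕ Fin n → L.Term (β ⊕ Fin m)) (a : α) :
    liftSubst ρ (.inl a) = (ρ (.inl a)).subst fun x => .var (Sum.map id Fin.castSucc x) := rfl

@[simp]
theorem liftSubst_last {n m : ℕ} (ρ : α ⊕ Fin n → L.Term (β ⊕ Fin m)) :
    liftSubst ρ (.inr (Fin.last n)) = .var (.inr (Fin.last m)) := by
  simp [liftSubst]

@[simp]
theorem liftSubst_castSucc {n m : ℕ} (ρ : α ⊕ Fin n → L.Term (β ⊕ Fin m)) (j : Fin n) :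
    liftSubst ρ (.inr j.castSucc) =
      (ρ (.inr j)).subst fun x => .var (Sum.map id Fin.castSucc x) := by
  simp [liftSubst]

/-- Both lifts fix the newest bound variable. Every other value is a weakened old term, and
weakening commutes with substitution. -/
theorem liftSubst_subst {n m k : ℕ} (ρ : α ⊕ Fin n → L.Term (β ⊕ Fin m))
    (τ : β ⊕ Fin m → L.Term (γ ⊕ Fin k)) :
    (fun x => (liftSubst ρ x).subst (liftSubst τ)) = liftSubst fun x => (ρ x).subst τ := by
  have key : (fun x => liftSubst τ (Sum.map id Fin.castSucc x)) =
      fun x => (τ x).subst fun y => .var (Sum.map id Fin.castSucc y) := by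
    funext x
    rcases x with b | j <;> simp
  funext x
  rcases x with a | i
  · simp [term_subst_subst, Term.subst, key]
  · refine Fin.lastCases ?_ (fun j => ?_) i
    · simp [Term.subst]
    · simp [term_subst_subst, Term.subst, key]

/-- `subst`, `relabel` and `toFormula` all become instances of `bsubst`, so this one law lets any
composite of them be compared through its action on variables. -/
theorem bsubst_bsubst {n m k : ℕ} (φ : L.BoundedFormula α n) (ρ : α ⊕ Fin n → L.Term (β ⊕ Fin m))
    (τ : β ⊕ Fin m → L.Term (γ ⊕ Fin k)) :
    bsubst τ (bsubst ρ φ) = bsubst (fun x => (ρ x).subst τ) φ := by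
  induction φ generalizing m k with
  | falsum => rfl
  | equal => simp only [bsubst, term_subst_subst]
  | rel => simp only [bsubst, term_subst_subst]
  | imp _ _ ih₁ ih₂ => simp only [bsubst, ih₁, ih₂]
  | all _ ih => simp only [bsubst, ih, liftSubst_subst]

theorem subst_eq_bsubst {n : ℕ} (φ : L.BoundedFormula α n) (f : α → L.Term β) :
    φ.subst f = bsubst (Sum.elim (fun a => (f a).subst fun b => .var (.inl b))
      fun i => .var (.inr i)) φ := by
  have key (n : ℕ) : Sum.elim (Term.relabel Sum.inl ∘ f) (Term.var ∘ Sum.inr) =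
      (Sum.elim (fun a => (f a).subst fun b => .var (.inl b)) fun i => .var (.inr i) :
        α ⊕ Fin n → L.Term (β ⊕ Fin n)) := by
    funext x
    rcases x with a | i <;> simp [term_relabel_eq_subst]
  unfold BoundedFormula.subst
  induction φ with
  | falsum => rfl
  | equal => simp only [bsubst, BoundedFormula.mapTermRel, key]
  | rel => simp only [bsubst, BoundedFormula.mapTermRel, key, id]
  | imp _ _ ih₁ ih₂ => simp only [bsubst, BoundedFormula.mapTermRel, ih₁, ih₂]
  | all _ ih =>
    simp only [bsubst, BoundedFormula.mapTermRel, ih, id]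
    congr 2
    funext x
    rcases x with a | i
    · simp [term_subst_subst, Term.subst]
    · refine Fin.lastCases ?_ (fun j => ?_) i <;> simp [Term.subst]

theorem relabel_eq_bsubst {n k : ℕ} (g : α → β ⊕ Fin n) (φ : L.BoundedFormula α k) :
    φ.relabel g = bsubst (fun x => .var (BoundedFormula.relabelAux g k x)) φ := by
  induction φ with
  | falsum => rfl
  | equal => simp only [bsubst, BoundedFormula.relabel, BoundedFormula.mapTermRel,
      term_relabel_eq_subst]
  | rel => simp only [bsubst, BoundedFormula.relabel, BoundedFormula.mapTermRel,
      term_relabel_eq_subst, id]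
  | imp _ _ ih₁ ih₂ => rw [BoundedFormula.relabel_imp, ih₁, ih₂]; rfl
  | @all k _ ih =>
    rw [BoundedFormula.relabel_all]
    refine (congrArg BoundedFormula.all ih).trans ?_
    simp only [bsubst]
    congr 2
    funext x
    rcases x with a | i
    · rcases h : g a with b | j <;>
        simp [BoundedFormula.relabelAux, h, Term.subst]
      rfl
    · refine Fin.lastCases ?_ (fun j => ?_) i
      · simp [BoundedFormula.relabelAux]
      · simp [BoundedFormula.relabelAux, Term.subst]

theorem toFormula_eq_bsubst {n : ℕ} (φ : L.BoundedFormula α n) :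
    φ.toFormula = bsubst (fun x => .var (.inl x)) φ := by
  induction φ with
  | falsum => rfl
  | equal => simp only [bsubst, BoundedFormula.toFormula, Term.equal, Term.bdEqual,
      term_relabel_eq_subst]
  | rel => simp only [bsubst, BoundedFormula.toFormula, Relations.formula,
      Relations.boundedFormula, term_relabel_eq_subst]
  | imp _ _ ih₁ ih₂ => simp only [bsubst, BoundedFormula.toFormula, ih₁, ih₂]
  | @all n _ ih =>
    simp only [bsubst, BoundedFormula.toFormula]
    congr 1
    refine (relabel_eq_bsubst _ _).trans ?_
    rw [ih, bsubst_bsubst]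
    congr 1
    funext x
    rcases x with a | i
    · simp [BoundedFormula.relabelAux, Term.subst]
    · refine Fin.lastCases ?_ (fun j => ?_) i
      -- The last of the `n + 1` variables is the one that the quantifier binds; `toFormula` splits
      -- it off so that `relabel` can bind it again.
      · have : finSumFinEquiv.symm (Fin.last n) = (.inr 0 : Fin n ⊕ Fin 1) := by
          rw [Equiv.symm_apply_eq]; rfl
        simp [BoundedFormula.relabelAux, Term.subst, this]
        rfl
      · have : finSumFinEquiv.symm j.castSucc = (.inl j : Fin n ⊕ Fin 1) := by
          rw [Equiv.symm_apply_eq]; rfl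
        simp [BoundedFormula.relabelAux, Term.subst, this]

theorem toFormula_subst (φ : L.BoundedFormula α 1) (f : α ⊕ Fin 1 → L.Term β) :
    φ.toFormula.subst f =
      bsubst (m := 0) (fun x => (f x).subst fun b => .var (.inl b)) φ := by
  rw [toFormula_eq_bsubst, subst_eq_bsubst, bsubst_bsubst]
  rfl

theorem formula_subst_eq_bsubst (φ : L.Formula α) (f : α → L.Term β) :
    φ.subst f = bsubst (m := 0) (Sum.elim (fun a => (f a).subst fun b => .var (.inl b))
      Fin.elim0) φ := by
  rw [subst_eq_bsubst]
  congr 2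
  exact Subsingleton.elim _ _

theorem formula_subst_subst (φ : L.Formula α) (f : α → L.Term β) (h : β → L.Term γ) :
    (φ.subst f : L.Formula β).subst h = φ.subst fun a => (f a).subst h := by
  simp only [formula_subst_eq_bsubst, bsubst_bsubst]
  congr 1
  funext x
  rcases x with a | i
  · simp [term_subst_subst, Term.subst]
  · exact i.elim0

/-- A sentence has no free variables to renumber. Hence the freshness condition of `allIntro` costs
nothing when the hypotheses are axioms. -/
theorem shift_openSentence (S : L.Sentence) : shift (openSentence S) = openSentence S := by
  unfold shift openSentence
  rw [formula_subst_subst]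
  exact congrArg _ (Subsingleton.elim _ _)

theorem shift_image_openSentence (T : L.Theory) :
    shift '' (openSentence '' T) = openSentence '' T := by
  simp only [Set.image_image, shift_openSentence]

theorem openSentence_sub (P : Predicate L) (t : L.Term Empty) :
    openSentence (sub P t) = P.subst fun _ => closedTerm t :=
  formula_subst_subst ..

/-- The body of the universally quantified sentence `forallSentence P`. -/
def forallBody (P : Predicate L) : L.BoundedFormula ℕ 1 :=
  bsubst (Sum.elim (fun _ => .var (.inr 0)) Fin.elim0) P

theorem openSentence_forallSentence (P : Predicate L) :
    openSentence (forallSentence P) = (forallBody P).all := by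
  unfold openSentence forallSentence forallBody
  refine congrArg BoundedFormula.all ((subst_eq_bsubst _ _).trans ?_)
  refine (congrArg _ (relabel_eq_bsubst _ _)).trans ((bsubst_bsubst _ _ _).trans ?_)
  congr 1
  funext x
  rcases x with a | i
  · rw [Subsingleton.elim a 0]
    rfl
  · exact i.elim0

theorem instantiate_forallBody (P : Predicate L) (t : L.Term ℕ) :
    instantiate (forallBody P).toFormula t = P.subst fun _ => t := by
  unfold instantiate forallBody
  rw [toFormula_subst, bsubst_bsubst, formula_subst_eq_bsubst]
  congr 1
  funext x
  rcases x with a | i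
  · rfl
  · exact i.elim0

end Substitution

/-! ### Derived rules of the predicate calculus -/

section Derivations

variable {L : FirstOrder.Language.{u, v}} {Γ Δ : Set (L.Formula ℕ)} {φ ψ : L.Formula ℕ}

theorem Derivable.mono (h : Derivable Γ φ) (hΓ : Γ ⊆ Δ) : Derivable Δ φ := by
  induction h generalizing Δ with
  | hyp h => exact .hyp (hΓ h)
  | impIntro _ ih => exact .impIntro (ih (Set.insert_subset_insert hΓ))
  | impElim _ _ ih₁ ih₂ => exact .impElim (ih₁ hΓ) (ih₂ hΓ)
  | byContradiction _ ih => exact .byContradiction (ih (Set.insert_subset_insert hΓ))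
  | allIntro _ ih => exact .allIntro (ih (Set.image_mono hΓ))
  | allElim t _ ih => exact .allElim t (ih hΓ)
  | eqRefl t => exact .eqRefl t
  | eqSubst χ _ _ ih₁ ih₂ => exact .eqSubst χ (ih₁ hΓ) (ih₂ hΓ)

theorem Derivable.weaken (h : Derivable Γ φ) : Derivable (insert ψ Γ) φ :=
  h.mono (Set.subset_insert _ _)

theorem Derivable.exFalso (h : Derivable Γ ⊥) : Derivable Γ φ :=
  .byContradiction h.weaken

/-- Conjunction abbreviates `¬ (φ → ¬ ψ)`, and `¬ φ` would give `φ → ¬ ψ` vacuously. -/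
theorem Derivable.andLeft (h : Derivable Γ (φ ⊓ ψ)) : Derivable Γ φ :=
  .byContradiction <| .impElim h.weaken <| .impIntro <| .exFalso <|
    .impElim (.hyp (Set.mem_insert_of_mem _ (Set.mem_insert _ _))) (.hyp (Set.mem_insert _ _))

theorem Derivable.andRight (h : Derivable Γ (φ ⊓ ψ)) : Derivable Γ ψ :=
  .byContradiction <| .impElim h.weaken <| .impIntro <|
    .hyp (Set.mem_insert_of_mem _ (Set.mem_insert _ _))

theorem Derivable.mp (h : Derivable Γ (φ.iff ψ)) (hφ : Derivable Γ φ) : Derivable Γ ψ :=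
  .impElim h.andLeft hφ

theorem Derivable.mpr (h : Derivable Γ (φ.iff ψ)) (hψ : Derivable Γ ψ) : Derivable Γ φ :=
  .impElim h.andRight hψ

/-- Leibniz's law for predicates: `P(t)` is an instance of `forallBody P`, which is the shape that
`eqSubst` requires. -/
theorem Derivable.subst_of_equal (P : Predicate L) {s t : L.Term ℕ}
    (h : Derivable Γ (s.equal t)) (hs : Derivable Γ (P.subst fun _ => s)) :
    Derivable Γ (P.subst fun _ => t) := by
  rw [← instantiate_forallBody] at hs ⊢
  exact .eqSubst _ h hs

theorem Proves.not_mt {T : L.Theory} {S S' : L.Sentence} (h : Proves T (S.iff S'))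
    (hS : Proves T S'.not) : Proves T S.not :=
  .impIntro <| .impElim (Derivable.weaken hS) <|
    .mp (φ := openSentence S) (Derivable.weaken h) <| .hyp (Set.mem_insert _ _)

/-! ### Diagonalization -/

/-- The predicate `∀ z, σ(x, x, z) → ¬ P z`. -/
def diagonal (σ : L.Formula (Fin 3)) (P : Predicate L) : Predicate L :=
  ((bsubst (Sum.elim ![.var (.inl 0), .var (.inl 0), .var (.inr 0)] Fin.elim0) σ).imp
    (bsubst (Sum.elim (fun _ => .var (.inr 0)) Fin.elim0) P).not).all

/-- The body of the sentence obtained from `diagonal σ P` by substituting `t`. -/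
def diagonalBody (σ : L.Formula (Fin 3)) (P : Predicate L) (t : L.Term Empty) :
    L.BoundedFormula ℕ 1 :=
  (bsubst (Sum.elim ![closedTerm t, closedTerm t, .var (.inr 0)] Fin.elim0) σ).imp
    (bsubst (Sum.elim (fun _ => .var (.inr 0)) Fin.elim0) P).not

theorem openSentence_sub_diagonal (σ : L.Formula (Fin 3)) (P : Predicate L) (t : L.Term Empty) :
    openSentence (sub (diagonal σ P) t) = (diagonalBody σ P t).all := by
  rw [openSentence_sub, subst_eq_bsubst]
  simp only [diagonal, diagonalBody, bsubst, BoundedFormula.not, bsubst_bsubst, closedTerm_subst]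
  congr 3
  · funext x
    rcases x with a | i
    · fin_cases a <;> simp [Term.subst, closedTerm_subst]
      rfl
    · exact i.elim0
  · congr 1
    funext x
    rcases x with a | i
    · rfl
    · exact i.elim0

theorem diagonalBody_toFormula_subst (σ : L.Formula (Fin 3)) (P : Predicate L)
    (t : L.Term Empty) (f : ℕ ⊕ Fin 1 → L.Term ℕ) :
    (diagonalBody σ P t).toFormula.subst f =
      BoundedFormula.imp (σ.subst ![closedTerm t, closedTerm t, f (.inr 0)])
        (BoundedFormula.not (P.subst fun _ => f (.inr 0))) := by
  rw [toFormula_subst]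
  simp only [diagonalBody, bsubst, BoundedFormula.not, bsubst_bsubst, formula_subst_eq_bsubst]
  congr 2
  · funext x
    rcases x with a | i
    · fin_cases a <;> simp [Term.subst, closedTerm_subst]
    · exact i.elim0
  · congr 1
    funext x
    rcases x with a | i
    · rfl
    · exact i.elim0

/-- The value at `c` of the statement that `σ(s, t, ·)` defines `r`. -/
theorem Proves.instantiate_defines {T : L.Theory} {σ : L.Formula (Fin 3)} {s t r : L.Term Empty}
    (h : Proves T (forallSentence
      ((σ.subst ![closedTerm s, closedTerm t, Term.var 0]).iff
        ((Term.var 0).equal (closedTerm r))))) (c : L.Term ℕ) :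
    Derivable (openSentence '' T)
      (Formula.iff (σ.subst ![closedTerm s, closedTerm t, c]) (c.equal (closedTerm r))) := by
  unfold Proves at h
  rw [openSentence_forallSentence] at h
  have h' := Derivable.allElim c h
  rw [instantiate_forallBody] at h'
  convert h' using 1
  change _ = BoundedFormula.iff (BoundedFormula.subst _ _) (BoundedFormula.subst _ _)
  congr 1
  · rw [formula_subst_subst]
    congr 1
    funext i
    fin_cases i <;> simp [Term.subst, closedTerm_subst]
  · rw [formula_subst_eq_bsubst]
    simp only [Term.equal, Term.bdEqual, bsubst, term_relabel_eq_subst,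
      Term.subst, Sum.elim_inl, closedTerm_subst]

/-- If `σ(t, t, ·)` defines `r`, then the diagonal sentence at `t` is equivalent to `¬ P r`. -/
theorem proves_sub_diagonal_iff {T : L.Theory} {σ : L.Formula (Fin 3)} {t r : L.Term Empty}
    (h : Proves T (forallSentence
      ((σ.subst ![closedTerm t, closedTerm t, Term.var 0]).iff
        ((Term.var 0).equal (closedTerm r))))) (P : Predicate L) :
    Proves T (sub (diagonal σ P) t) ↔ Proves T (sub P r).not := by
  have hnot : openSentence (sub P r).not =
      BoundedFormula.not (P.subst fun _ => closedTerm r) :=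
    congrArg BoundedFormula.not (openSentence_sub P r)
  unfold Proves
  rw [openSentence_sub_diagonal, hnot]
  constructor
  · intro hD
    have hr := Derivable.allElim (closedTerm r) hD
    unfold instantiate at hr
    rw [diagonalBody_toFormula_subst] at hr
    -- At `z = r` the premise `σ(t, t, r)` amounts to `r = r`.
    exact .impElim hr (.mpr (h.instantiate_defines _) (.eqRefl _))
  · intro hP
    refine .allIntro ?_
    -- The fresh variable `0` plays the role of `z`. From `σ(t, t, z)` follows `z = r`, so `P z`
    -- yields `P r`, against `hP`.
    rw [shift_image_openSentence, diagonalBody_toFormula_subst]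
    refine .impIntro (.impIntro (.impElim hP.weaken.weaken ?_))
    refine .subst_of_equal P (s := Term.var 0) (.mp (h.instantiate_defines _).weaken.weaken (.hyp ?_))
      (.hyp ?_)
    · exact Set.mem_insert_of_mem _ (Set.mem_insert _ _)
    · exact Set.mem_insert _ _

end Derivations

end StringTheory

theorem mainTheorem1 {L : FirstOrder.Language.{u, v}}
    {L' : FirstOrder.Language.{u', v'}} (META : L.Theory) (Th : L'.Theory)
    (q : StringTheory.Meta L L') (g : StringTheory.ModellingTransformation META Th)
    (hMETA : StringTheory.IsDecidable META)
    (hsub : ∃ σ : L.Formula (Fin 3), StringTheory.ExpressesSubstitution q g σ) :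
    ¬ ∃ Tr : StringTheory.Predicate L, StringTheory.IsTruthPredicate q g Tr := by
  rintro ⟨Tr, hTr⟩
  obtain ⟨σ, hσ⟩ := hsub
  obtain ⟨hcons, hcomp⟩ := hMETA
  -- The diagonal choice: the same string serves as the code of the predicate and as the argument
  -- put into it, so both inputs of `σ` coincide.
  set s := StringTheory.predicateString (g.pred (StringTheory.diagonal σ Tr))
  set S := StringTheory.sub (StringTheory.diagonal σ Tr) (q.quote s)
  have hS := StringTheory.proves_sub_diagonal_iff (hσ (StringTheory.diagonal σ Tr) s) Tr
  rcases hcomp S with h | h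
  · exact hcons _ ⟨StringTheory.Derivable.mpr (hTr S) h, hS.1 h⟩
  -- Refuting `S` refutes `Tr(g(S))`, which is what `S` asserts, so `S` is proved as well.
  · exact hcons S ⟨hS.2 (StringTheory.Proves.not_mt (hTr S) h), h⟩
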